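/- Theorem. By a ring we mean a structure $(A,+,\cdot)$ such that $(A,+)$ is an abelian group and $(x,y)\mapsto x\cdot y$ is biadditive (not necessarily unital, commutative or associative); it is an FDZ-ring if $(A,+)$ is finitely generated. Put $\mathrm{Ann}(A)=\{x\in A\mid xy=yx=0 \text{ for all } y\in A\}$, let $A^2$ be the set of finite sums $x_1y_1+\cdots+x_ny_n$ with $x_i,y_i\in A$, and let $\Delta(A)=\{x\in A\mid nx\in A^2\text{ for some integer } n\ge 1\}$. Let $A$ be an FDZ-ring such that $\mathrm{Ann}(A)$ is infinite and $\Delta(A)\neq A$. Then $A$ is not bi-interpretable (with parameters) with the ring of integers $\mathbb{Z}$. Here structures $M$ and $N$ are bi-interpretable if there are interpretations, with parameters, of $M$ in $N$ and of $N$ in $M$, such that there exist an isomorphism from $M$ onto the copy $\widetilde M$ of $M$ decoded inside $M$ from the copy of $N$ in $M$, which is first-order definable in $M$ with parameters, and an isomorphism from $N$ onto the copy $\widetilde N$ of $N$ decoded inside $N$ from the copy of $M$ in $N$, which is first-order definable in $N$ with parameters. -/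

import Mathlib

open scoped FirstOrder

/-! ### The first-order language of (not necessarily unital or associative) rings -/

/-- The function symbols `+` and `·`, both binary. -/
inductive RngFunc : ℕ → Type
  | add : RngFunc 2
  | mul : RngFunc 2

/-- The language of structures `(A, +, ·)`. (The constant `0`, the operation `-` and, for a unital
ring, the constant `1` are definable without parameters.) -/
def rngLanguage : FirstOrder.Language.{0, 0} where
  Functions := RngFunc
  Relations := fun _ => Empty

/-- Every (nonunital, nonassociative) ring is a structure `(A, +, ·)`. -/
instance rngStructure (A : Type*) [NonUnitalNonAssocRing A] : rngLanguage.Structure A where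
  funMap := fun {_} F =>
    match F with
    | RngFunc.add => fun v => v 0 + v 1
    | RngFunc.mul => fun v => v 0 * v 1
  RelMap := fun {_} R => R.elim

/-! ### Interpretations and bi-interpretability (with parameters) -/

/-- A coordinate map from `N` to `M`: a surjection onto `M` from a set of `ι`-tuples of elements
of `N`. -/
structure CoordMap (ι : Type) (N : Type*) (M : Type*) where
  domain : Set (ι → N)
  toFun : domain → M
  surjective : Function.Surjective toFun

namespace CoordMap

variable {ι κ : Type} {A B C M N : Type*}

/-- The preimage, as a set of `γ`-tuples of `ι`-tuples from `N`, of a set `S` of `γ`-tuples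
from `M`. -/
def pullback (f : CoordMap ι N M) {γ : Type} (S : Set (γ → M)) : Set (γ × ι → N) :=
  {x | ∃ h : ∀ j, (fun i => x (j, i)) ∈ f.domain, (fun j => f.toFun ⟨_, h j⟩) ∈ S}

/-- The coordinate map `f` is an interpretation (with parameters) of the `L`-structure `M` in the
`K`-structure `N`: the domain of `f`, the kernel of `f`, and the preimages of the graphs of the
functions and of the relations of `M` are first-order definable in `N` with parameters. -/
structure IsInterpretation (L K : FirstOrder.Language) [L.Structure M] [K.Structure N]
    (f : CoordMap ι N M) : Prop where
  domain : Set.univ.Definable K f.domain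
  eq : Set.univ.Definable K (f.pullback {v : Fin 2 → M | v 0 = v 1})
  function : ∀ (n : ℕ) (F : L.Functions n), Set.univ.Definable K
    (f.pullback {v : Fin (n + 1) → M |
      v (Fin.last n) = FirstOrder.Language.Structure.funMap F (fun i : Fin n => v i.castSucc)})
  relation : ∀ (n : ℕ) (R : L.Relations n), Set.univ.Definable K
    (f.pullback {v : Fin n → M | FirstOrder.Language.Structure.RelMap R v})

/-- Composition of coordinate maps: an element of `C` is coded by a tuple from `B`, each entry of
which is coded by a tuple from `A`. -/
def comp (f : CoordMap ι B C) (g : CoordMap κ A B) : CoordMap (ι × κ) A C where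
  domain := g.pullback f.domain
  toFun x := f.toFun ⟨fun i => g.toFun ⟨_, x.2.fst i⟩, x.2.snd⟩
  surjective c := by
    obtain ⟨⟨y, hy⟩, rfl⟩ := f.surjective c
    choose z hz using fun i => g.surjective (y i)
    have e : (fun i => g.toFun ⟨fun k => (z i).1 k, (z i).2⟩) = y := funext hz
    exact ⟨⟨fun p => (z p.1).1 p.2, fun i => (z i).2, by rw [e]; exact hy⟩,
      congrArg f.toFun (Subtype.ext e)⟩

/-- The copy of `M` inside `N` given by the coordinate map `f`: the set of codes, modulo the
relation of coding the same element. -/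
def Copy (f : CoordMap ι N M) : Type _ := Quotient (Setoid.ker f.toFun)

/-- The element of the copy that is represented by a code. -/
def Copy.mk (f : CoordMap ι N M) (x : f.domain) : f.Copy := Quotient.mk (Setoid.ker f.toFun) x

/-- The bijection between the copy of `M` and `M` that is induced by the coordinate map. -/
noncomputable def copyEquiv (f : CoordMap ι N M) : f.Copy ≃ M :=
  Setoid.quotientKerEquivOfSurjective f.toFun f.surjective

/-- The structure on the copy: its functions and relations are read off from `M` on codes. -/
noncomputable instance (L : FirstOrder.Language) [L.Structure M] (f : CoordMap ι N M) :
    L.Structure f.Copy :=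
  f.copyEquiv.symm.inducedStructure

/-- For a copy of `M` inside `M` itself: some isomorphism of `M` onto this copy is first-order
definable in `M` with parameters, as a relation between elements of `M` and codes. -/
def HasDefinableIso (L : FirstOrder.Language) [L.Structure M] (f : CoordMap ι M M) : Prop :=
  ∃ Φ : M ≃[L] f.Copy, Set.univ.Definable L
    {v : Option ι → M | ∃ h : (fun i => v (some i)) ∈ f.domain, Φ (v none) = Copy.mk f ⟨_, h⟩}

end CoordMap

/-- The `L`-structure `M` and the `K`-structure `N` are bi-interpretable (with parameters): there
are interpretations of each in the other such that `M` is definably isomorphic to the copy of `M`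
that is decoded in `M` from the copy of `N` in `M`, and `N` is definably isomorphic to the copy of
`N` that is decoded in `N` from the copy of `M` in `N`. -/
def BiInterpretable (L K : FirstOrder.Language) (M N : Type*) [L.Structure M] [K.Structure N] : Prop :=
  ∃ (d e : ℕ) (f : CoordMap (Fin d) N M) (g : CoordMap (Fin e) M N),
    f.IsInterpretation L K ∧ g.IsInterpretation K L ∧
    (f.comp g).HasDefinableIso L ∧ (g.comp f).HasDefinableIso K

/-! ### Ideals of a ring -/

section Ideals

variable (A : Type*) [NonUnitalNonAssocRing A]

/-- The two-sided annihilator `Ann(A)`. -/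
def ringAnn : AddSubgroup A where
  carrier := {x | ∀ y, x * y = 0 ∧ y * x = 0}
  zero_mem' := by simp
  add_mem' := fun hx hy z => by simp [add_mul, mul_add, hx z, hy z]
  neg_mem' := fun hx z => by simp [hx z]

/-- `A²`, the set of all finite sums of products `x * y`. -/
def ringSq : AddSubgroup A where
  carrier := {z | ∃ (n : ℕ) (x y : Fin n → A), z = ∑ i, x i * y i}
  zero_mem' := ⟨0, Fin.elim0, Fin.elim0, by simp⟩
  add_mem' := by
    rintro _ _ ⟨n, x, y, rfl⟩ ⟨m, x', y', rfl⟩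
    exact ⟨n + m, Fin.append x x', Fin.append y y', by simp [Fin.sum_univ_add]⟩
  neg_mem' := by
    rintro _ ⟨n, x, y, rfl⟩
    exact ⟨n, -x, y, by simp⟩

variable {A} in
/-- The isolator `Is(I) = {x | n x ∈ I for some n ≥ 1}`. -/
def isolator (I : AddSubgroup A) : AddSubgroup A where
  carrier := {x | ∃ n : ℕ, 0 < n ∧ n • x ∈ I}
  zero_mem' := ⟨1, one_pos, by simp⟩
  add_mem' := by
    rintro x y ⟨n, hn, hx⟩ ⟨m, hm, hy⟩
    refine ⟨m * n, Nat.mul_pos hm hn, ?_⟩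
    rw [smul_add, mul_smul, mul_comm, mul_smul]
    exact I.add_mem (I.nsmul_mem hx m) (I.nsmul_mem hy n)
  neg_mem' := by
    rintro x ⟨n, hn, hx⟩
    exact ⟨n, hn, by rw [smul_neg]; exact I.neg_mem hx⟩

/-- `Δ(A) = Is(A²)`. -/
def ringDelta : AddSubgroup A := isolator (ringSq A)

end Ideals

/-! Bi-interpretability with `ℤ` forces a definable total preorder on `A` with finite initial
segments. Lagrange's theorem defines comparison of absolute values in `ℤ`, so elements of `A` can be
compared by the least height of their integer codes, and the definable isomorphism of `A` with its
decoded copy brings this comparison back into `A` (`BiInterpretable.exists_definable_rank`).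

Such a preorder contradicts the symmetry of an ultrapower of `A`. The hypotheses give a nonzero
additive `π : A → ℤ` that kills products and a `z` of infinite order in the annihilator. If `N` is
divisible by every positive standard integer and `ψ` is a `ℚ`-linear functional on germs with `ψ 1 =
0`, then `x ↦ x + t ψ(π x) N z` respects both operations and fixes the constants; it is an
automorphism unless `1 + t ψ(π(N z)) = 0`. When `π a` is independent of `1` and `π b`, such a map
moves `a` beyond the initial segment of `b` while fixing `b`, so `a ≤ b` fails
(`not_eventually_rank_le`). The sequences `i • e` and `i ^ 2 • e` are then incomparable, against
totality. -/

section

open FirstOrder Set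

/-! ### Pulling definable sets back along an interpretation -/

namespace CoordMap

variable {ι : Type} {M N : Type*} {L K : FirstOrder.Language} [L.Structure M] [K.Structure N]

theorem exists_codes (f : CoordMap ι N M) {γ : Type} (v : γ → M) :
    ∃ z : γ → f.domain, (fun j => f.toFun (z j)) = v := by
  choose z hz using fun j => f.surjective (v j)
  exact ⟨z, funext hz⟩

/-- The tuples all of whose entries are codes. -/
theorem pullback_univ (f : CoordMap ι N M) {γ : Type} :
    f.pullback (univ : Set (γ → M)) = ⋂ j, {x | (fun i => x (j, i)) ∈ f.domain} := by
  ext x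
  simp [pullback]

theorem pullback_compl (f : CoordMap ι N M) {γ : Type} (S : Set (γ → M)) :
    f.pullback Sᶜ = f.pullback univ \ f.pullback S := by
  ext x
  simp only [pullback, mem_ofPred_eq, mem_compl_iff, mem_univ, exists_prop, and_true, mem_sdiff]
  exact ⟨fun ⟨h, h'⟩ => ⟨h, fun ⟨_, k⟩ => h' k⟩, fun ⟨h, h'⟩ => ⟨h, fun k => h' ⟨h, k⟩⟩⟩

theorem pullback_inter (f : CoordMap ι N M) {γ : Type} (S T : Set (γ → M)) :
    f.pullback (S ∩ T) = f.pullback S ∩ f.pullback T := by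
  ext x
  exact ⟨fun ⟨h, h'⟩ => ⟨⟨h, h'.1⟩, ⟨h, h'.2⟩⟩, fun ⟨⟨h, h'⟩, ⟨_, k⟩⟩ => ⟨h, h', k⟩⟩

theorem pullback_iInter (f : CoordMap ι N M) {γ δ : Type} (S : δ → Set (γ → M)) :
    f.pullback (⋂ d, S d) = f.pullback univ ∩ ⋂ d, f.pullback (S d) := by
  ext x
  simp only [pullback, mem_ofPred_eq, mem_iInter, mem_univ, exists_prop, and_true, mem_inter_iff]
  exact ⟨fun ⟨h, h'⟩ => ⟨h, fun d => ⟨h, h' d⟩⟩, fun ⟨h, h'⟩ => ⟨h, fun d => (h' d).2⟩⟩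

theorem pullback_preimage (f : CoordMap ι N M) {γ δ : Type} (S : Set (γ → M)) (h : γ → δ) :
    f.pullback {v : δ → M | v ∘ h ∈ S} =
      f.pullback univ ∩ {x | (x ∘ Prod.map h id) ∈ f.pullback S} := by
  ext x
  simp only [pullback, mem_ofPred_eq, mem_univ, exists_prop, and_true, mem_inter_iff]
  exact ⟨fun ⟨k, k'⟩ => ⟨k, fun j => k (h j), k'⟩, fun ⟨k, ⟨_, k'⟩⟩ => ⟨k, k'⟩⟩

/-- Surjectivity gives every witness a code, and membership in a pullback already forces the tuple
`y` to consist of codes. -/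
theorem pullback_exists (f : CoordMap ι N M) {γ δ : Type} (S : Set (γ ⊕ δ → M)) :
    f.pullback {v : γ → M | ∃ w : δ → M, Sum.elim v w ∈ S} =
      {x | ∃ y : δ × ι → N,
        (Sum.elim x y ∘ (Equiv.sumProdDistrib γ δ ι)) ∈ f.pullback S} := by
  ext x
  constructor
  · rintro ⟨h, w, hw⟩
    obtain ⟨z, rfl⟩ := f.exists_codes w
    refine ⟨fun p => (z p.1).1 p.2, ?_, ?_⟩
    · rintro (j | j)
      · exact h j
      · exact (z j).2
    · convert hw using 1
      funext j
      cases j <;> rfl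
  · rintro ⟨y, h, hy⟩
    refine ⟨fun j => h (Sum.inl j), fun j => f.toFun ⟨_, h (Sum.inr j)⟩, ?_⟩
    convert hy using 1
    funext j
    cases j <;> rfl

/-- The preimage of `S` under the coordinate map `f` is definable with parameters. -/
def Tame (K : FirstOrder.Language) [K.Structure N] (f : CoordMap ι N M) {γ : Type}
    (S : Set (γ → M)) : Prop :=
  univ.Definable K (f.pullback S)

variable {f : CoordMap ι N M} {γ δ : Type}

theorem Tame.inter {S T : Set (γ → M)} (hS : f.Tame K S) (hT : f.Tame K T) :
    f.Tame K (S ∩ T) := by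
  rw [Tame, pullback_inter]
  exact Set.Definable.inter hS hT

theorem tame_univ (hf : univ.Definable K f.domain) [Finite γ] :
    f.Tame K (univ : Set (γ → M)) := by
  rw [Tame, pullback_univ]
  exact definable_iInter_of_finite fun j => hf.preimage_comp fun i => (j, i)

theorem Tame.compl (hf : univ.Definable K f.domain) [Finite γ] {S : Set (γ → M)}
    (hS : f.Tame K S) : f.Tame K Sᶜ := by
  rw [Tame, pullback_compl]
  exact Set.Definable.sdiff (tame_univ hf) hS

theorem Tame.iInter (hf : univ.Definable K f.domain) [Finite γ] [Finite δ]
    {S : δ → Set (γ → M)} (hS : ∀ d, f.Tame K (S d)) : f.Tame K (⋂ d, S d) := by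
  rw [Tame, pullback_iInter]
  exact Set.Definable.inter (tame_univ hf) (definable_iInter_of_finite hS)

theorem Tame.preimage (hf : univ.Definable K f.domain) [Finite δ] {S : Set (γ → M)}
    (hS : f.Tame K S) (h : γ → δ) : f.Tame K {v : δ → M | v ∘ h ∈ S} := by
  rw [Tame, pullback_preimage]
  exact Set.Definable.inter (tame_univ hf) (Set.Definable.preimage_comp (Prod.map h id) hS)

variable [Finite ι]

theorem Tame.exists [Finite δ] {S : Set (γ ⊕ δ → M)}
    (hS : f.Tame K S) : f.Tame K {v : γ → M | ∃ w : δ → M, Sum.elim v w ∈ S} := by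
  rw [Tame, pullback_exists]
  exact Set.Definable.exists_of_finite
    (Set.Definable.preimage_comp (Equiv.sumProdDistrib γ δ ι) hS)

theorem tame_const (hf : f.IsInterpretation L K) (c : M) :
    f.Tame K {v : Fin 1 → M | v 0 = c} := by
  obtain ⟨⟨y, hy⟩, rfl⟩ := f.surjective c
  -- One fixed code `y` of `c` serves as a tuple of parameters; the codes of `c` are those
  -- equivalent to it.
  have h1 : univ.Definable K {w : Fin 2 × ι → N | ∀ i, w (1, i) = y i} := by
    have : {w : Fin 2 × ι → N | ∀ i, w (1, i) = y i} = ⋂ i, {w | w (1, i) = y i} := by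
      ext; simp
    rw [this]
    refine definable_iInter_of_finite fun i => ?_
    exact Set.Definable.preimage_comp (fun _ : Fin 1 => ((1 : Fin 2), i))
      (Set.Definable.singleton_of_mem K (mem_univ (y i)))
  have h2 := (Set.Definable.inter hf.eq h1).image_comp fun p : Fin 1 × ι => ((0 : Fin 2), p.2)
  rw [Tame]
  convert h2 using 1
  ext x
  constructor
  · rintro ⟨h, hx⟩
    refine ⟨fun p => if p.1 = 0 then x (0, p.2) else y p.2, ⟨⟨?_, ?_⟩, ?_⟩, ?_⟩
    · intro j
      fin_cases j
      · exact h 0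
      · exact hy
    · exact hx
    · intro i
      simp
    · funext p
      obtain ⟨p, i⟩ := p
      have : p = 0 := Subsingleton.elim _ _
      subst this
      simp
  · rintro ⟨w, ⟨⟨h, hw⟩, hwy⟩, rfl⟩
    refine ⟨fun _ => h 0, ?_⟩
    have e : y = fun i => w (1, i) := (funext hwy).symm
    subst e
    exact hw

/-- Substitution is eliminated by quantifying over auxiliary values `w i` constrained to the graphs
of the `t i`. -/
theorem tame_terms (hf : univ.Definable K f.domain) {n : ℕ} [Finite γ] {S : Set (Fin n → M)}
    (hS : f.Tame K S) (t : Fin n → (γ → M) → M)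
    (ht : ∀ i, f.Tame K {v : Option γ → M | v none = t i (v ∘ some)}) :
    f.Tame K {v : γ → M | (fun i => t i v) ∈ S} := by
  have h := Tame.exists (δ := Fin n) (γ := γ) (Tame.inter
    (Tame.iInter hf fun i => (ht i).preimage hf
      (fun o : Option γ => o.elim (Sum.inr i : γ ⊕ Fin n) Sum.inl))
    (hS.preimage hf (Sum.inr : Fin n → γ ⊕ Fin n)))
  convert h using 1
  ext v
  simp only [mem_ofPred_eq, mem_inter_iff, mem_iInter]
  constructor
  · intro hv
    exact ⟨fun i => t i v, fun i => rfl, hv⟩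
  · rintro ⟨w, hw, hw'⟩
    have : w = fun i => t i v := funext hw
    rw [← this]
    exact hw'

theorem tame_funMap (hf : f.IsInterpretation L K) {n : ℕ}
    (F : (L[[(univ : Set M)]]).Functions n) :
    f.Tame K {v : Fin (n + 1) → M | v (Fin.last n) =
      Language.Structure.funMap F (fun i : Fin n => v i.castSucc)} := by
  rcases F with F | F
  · exact hf.function n F
  · match n, F with
    | 0, F => exact tame_const hf _
    | n + 1, F => exact F.elim

theorem tame_term (hf : f.IsInterpretation L K) [Finite γ] (t : (L[[(univ : Set M)]]).Term γ) :
    f.Tame K {v : Option γ → M | v none = t.realize (v ∘ some)} := by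
  induction t with
  | var i =>
    exact Tame.preimage hf.domain hf.eq ![none, some i]
  | @func n F ts ih =>
    have := tame_terms hf.domain (γ := Option γ) (tame_funMap hf F)
      (Fin.snoc (fun i v => (ts i).realize (v ∘ some)) fun v => v none) ?_
    · convert this using 1
      ext v
      simp [Language.Term.realize]
    · intro i
      refine Fin.lastCases ?_ (fun i => ?_) i
      · simpa using Tame.preimage hf.domain hf.eq (δ := Option (Option γ)) ![none, some none]
      · simpa using! (ih i).preimage hf.domain (Option.map some)

theorem tame_boundedFormula (hf : f.IsInterpretation L K) [Finite γ] {n : ℕ}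
    (φ : (L[[(univ : Set M)]]).BoundedFormula γ n) :
    f.Tame K {v : γ ⊕ Fin n → M | φ.Realize (v ∘ Sum.inl) (v ∘ Sum.inr)} := by
  induction φ with
  | falsum =>
    simpa [Language.BoundedFormula.Realize] using
      Tame.compl hf.domain (tame_univ (γ := γ ⊕ Fin _) hf.domain)
  | @equal n t₁ t₂ =>
    convert tame_terms hf.domain hf.eq ![fun v => t₁.realize v, fun v => t₂.realize v] ?_ using 1
    · ext v
      simp [Language.BoundedFormula.Realize]
    · intro i
      fin_cases i
      · exact tame_term hf t₁
      · exact tame_term hf t₂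
  | @rel n l R ts =>
    rcases R with R | R
    · convert tame_terms hf.domain (hf.relation _ R) (fun i v => (ts i).realize v)
        (fun i => tame_term hf (ts i)) using 1
      ext v
      simp only [Language.BoundedFormula.Realize, Sum.elim_comp_inl_inr]
      rfl
    · exact R.elim
  | imp φ ψ ih₁ ih₂ =>
    convert ((ih₁.inter (ih₂.compl hf.domain)).compl hf.domain) using 1
    ext v
    simp [Language.BoundedFormula.Realize]
  | @all n φ ih =>
    -- The universal quantifier is rewritten as `¬∃¬`, with the last bound variable moved into a
    -- separate `Fin 1` block.
    have h := ((((ih.compl hf.domain).preimage hf.domain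
      (fun s => Sum.elim (fun i => Sum.inl (Sum.inl i))
        (Fin.snoc (α := fun _ => (γ ⊕ Fin n) ⊕ Fin 1) (fun i => Sum.inl (Sum.inr i))
          (Sum.inr 0)) s :
        γ ⊕ Fin (n + 1) → (γ ⊕ Fin n) ⊕ Fin 1)).exists).compl hf.domain)
    convert h using 1
    ext v
    simp only [Language.BoundedFormula.Realize, mem_ofPred_eq, mem_compl_iff, not_exists, not_not]
    have key : ∀ w : Fin 1 → M, (Sum.elim v w ∘ Fin.snoc (α := fun _ => (γ ⊕ Fin n) ⊕ Fin 1)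
        (fun i => Sum.inl (Sum.inr i)) (Sum.inr 0)) = Fin.snoc (v ∘ Sum.inr) (w 0) := by
      intro w
      funext i
      refine Fin.lastCases ?_ (fun i => ?_) i <;> simp
    constructor
    · intro hv w
      have := hv (w 0)
      rw [← key] at this
      exact this
    · intro hv x
      have := hv fun _ => x
      have k := key fun _ => x
      rw [← k]
      exact this

/-- Definable sets pull back to definable sets under an interpretation. -/
theorem IsInterpretation.definable_pullback (hf : f.IsInterpretation L K) [Finite γ]
    {S : Set (γ → M)} (hS : univ.Definable L S) : univ.Definable K (f.pullback S) := by
  obtain ⟨φ, rfl⟩ := hS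
  have := (tame_boundedFormula hf φ).preimage hf.domain
    (Sum.elim id Fin.elim0 : γ ⊕ Fin 0 → γ)
  rw [Tame] at this
  convert this using 2
  ext v
  simp only [Language.Formula.Realize, mem_ofPred_eq]
  exact iff_of_eq (congrArg _ (Subsingleton.elim _ _))

end CoordMap

/-! ### Definable comparison of heights and ranks over the integers -/

/-- The order of the absolute values of integers is definable, by Lagrange's four square theorem. -/
theorem definable_natAbs_le :
    (univ : Set ℤ).Definable rngLanguage {v : Fin 2 → ℤ | (v 0).natAbs ≤ (v 1).natAbs} := by
  let add (s t : rngLanguage[[(univ : Set ℤ)]].Term (Fin 2 ⊕ Fin 4)) :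
      rngLanguage[[(univ : Set ℤ)]].Term (Fin 2 ⊕ Fin 4) :=
    Language.Term.func (Sum.inl RngFunc.add) ![s, t]
  let sq (i : Fin 2 ⊕ Fin 4) : rngLanguage[[(univ : Set ℤ)]].Term (Fin 2 ⊕ Fin 4) :=
    Language.Term.func (Sum.inl RngFunc.mul) ![Language.Term.var i, Language.Term.var i]
  have hadd : ∀ s t (v : Fin 2 ⊕ Fin 4 → ℤ), (add s t).realize v = s.realize v + t.realize v := by
    intro s t (v : Fin 2 ⊕ Fin 4 → ℤ)
    simp only [add, Language.Term.realize]
    rfl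
  have hsq : ∀ i (v : Fin 2 ⊕ Fin 4 → ℤ), (sq i).realize v = v i * v i := by
    intro i (v : Fin 2 ⊕ Fin 4 → ℤ)
    simp only [sq, Language.Term.realize]
    rfl
  have h : (univ : Set ℤ).Definable rngLanguage
      {v : Fin 2 ⊕ Fin 4 → ℤ | v (Sum.inl 1) * v (Sum.inl 1) = v (Sum.inl 0) * v (Sum.inl 0) +
        (v (Sum.inr 0) * v (Sum.inr 0) + (v (Sum.inr 1) * v (Sum.inr 1) +
          (v (Sum.inr 2) * v (Sum.inr 2) + v (Sum.inr 3) * v (Sum.inr 3))))} := by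
    refine ⟨(sq (Sum.inl 1)).equal (add (sq (Sum.inl 0)) (add (sq (Sum.inr 0))
      (add (sq (Sum.inr 1)) (add (sq (Sum.inr 2)) (sq (Sum.inr 3)))))), ?_⟩
    ext v
    simp [Language.Formula.realize_equal, hadd, hsq]
  convert h.exists_of_finite using 1
  ext v
  simp only [mem_ofPred_eq, Sum.elim_inl, Sum.elim_inr]
  rw [Int.natAbs_le_iff_mul_self_le]
  constructor
  · intro hv
    obtain ⟨a, b, c, d, h⟩ := Nat.sum_four_squares (v 1 * v 1 - v 0 * v 0).toNat
    refine ⟨![a, b, c, d], ?_⟩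
    have : ((v 1 * v 1 - v 0 * v 0).toNat : ℤ) = v 1 * v 1 - v 0 * v 0 :=
      Int.toNat_of_nonneg (by linarith)
    rw [← h] at this
    push_cast at this
    simp
    linarith
  · rintro ⟨u, hu⟩
    nlinarith [mul_self_nonneg (u 0), mul_self_nonneg (u 1), mul_self_nonneg (u 2),
      mul_self_nonneg (u 3)]

namespace CoordMap

/-- The sup norm of an integer tuple. -/
def height {ι : Type} [Fintype ι] (y : ι → ℤ) : ℕ := Finset.univ.sup fun i => (y i).natAbs

theorem height_le_height {ι : Type} [Fintype ι] (x y : ι → ℤ) :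
    height x ≤ height y ↔ ∀ j, ∃ i, (x j).natAbs ≤ (y i).natAbs := by
  simp only [height, Finset.sup_le_iff, Finset.mem_univ, forall_const]
  refine forall_congr' fun j => ⟨fun h => ?_, fun ⟨i, h⟩ => h.trans
    (Finset.le_sup (f := fun i => (y i).natAbs) (Finset.mem_univ i))⟩
  obtain ⟨i, -, hi⟩ := Finset.exists_mem_eq_sup Finset.univ ⟨j, Finset.mem_univ j⟩
    fun i => (y i).natAbs
  exact ⟨i, h.trans hi.le⟩

theorem finite_height_le {ι : Type} [Fintype ι] (n : ℕ) : {y : ι → ℤ | height y ≤ n}.Finite := by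
  refine (Set.Finite.pi' (t := fun _ : ι => Icc (-(n : ℤ)) n) fun _ => finite_Icc _ _).subset ?_
  intro y hy i
  have : (y i).natAbs ≤ n :=
    (Finset.le_sup (f := fun i => (y i).natAbs) (Finset.mem_univ i)).trans hy
  exact ⟨by omega, by omega⟩

theorem definable_height_le {ι : Type} [Fintype ι] : (univ : Set ℤ).Definable rngLanguage
    {w : Fin 2 × ι → ℤ | height (fun i => w (0, i)) ≤ height (fun i => w (1, i))} := by
  simp only [height_le_height, ofPred_forall, ofPred_exists]
  refine definable_iInter_of_finite fun j => definable_iUnion_of_finite fun i => ?_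
  exact definable_natAbs_le.preimage_comp ![((0 : Fin 2), j), ((1 : Fin 2), i)]

variable {ι : Type} [Fintype ι] {M : Type*}

/-- The least height of a code. -/
noncomputable def rank (f : CoordMap ι ℤ M) (a : M) : ℕ :=
  sInf {n | ∃ y : f.domain, f.toFun y = a ∧ height y.1 = n}

theorem exists_height_eq_rank (f : CoordMap ι ℤ M) (a : M) :
    ∃ y : f.domain, f.toFun y = a ∧ height y.1 = f.rank a := by
  obtain ⟨y, hy⟩ := f.surjective a
  exact Nat.sInf_mem (s := {n | ∃ y : f.domain, f.toFun y = a ∧ height y.1 = n})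
    ⟨_, y, hy, rfl⟩

theorem rank_le (f : CoordMap ι ℤ M) (y : f.domain) : f.rank (f.toFun y) ≤ height y.1 :=
  Nat.sInf_le ⟨y, rfl, rfl⟩

theorem finite_rank_le (f : CoordMap ι ℤ M) (n : ℕ) : {a | f.rank a ≤ n}.Finite := by
  have h : (Subtype.val ⁻¹' {y : ι → ℤ | height y ≤ n} : Set f.domain).Finite :=
    (finite_height_le n).preimage Subtype.val_injective.injOn
  refine (h.image f.toFun).subset fun a ha => ?_
  obtain ⟨y, rfl, hy⟩ := f.exists_height_eq_rank a
  exact ⟨y, hy.le.trans ha, rfl⟩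

/-- This replaces the infimum in `rank` by quantifiers over codes, which is what makes the
comparison first-order. -/
theorem rank_le_rank (f : CoordMap ι ℤ M) (a b : M) : f.rank a ≤ f.rank b ↔
    ∀ y : f.domain, f.toFun y = b → ∃ x : f.domain, f.toFun x = a ∧ height x.1 ≤ height y.1 := by
  constructor
  · rintro h y rfl
    obtain ⟨x, hx, hx'⟩ := f.exists_height_eq_rank a
    exact ⟨x, hx, hx'.le.trans (h.trans (f.rank_le y))⟩
  · intro h
    obtain ⟨y, hy, hy'⟩ := f.exists_height_eq_rank b
    obtain ⟨x, rfl, hx⟩ := h y hy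
    exact (f.rank_le x).trans (hx.trans hy'.le)

theorem _root_.Set.Definable.relComp {κ : Type} [Finite κ] {N : Type*}
    {K : FirstOrder.Language} [K.Structure N] {R S : Set (Fin 2 × κ → N)}
    (hR : univ.Definable K R) (hS : univ.Definable K S) :
    univ.Definable K {w : Fin 2 × κ → N | ∃ y : κ → N,
      (fun p : Fin 2 × κ => if p.1 = 0 then w (0, p.2) else y p.2) ∈ R ∧
      (fun p : Fin 2 × κ => if p.1 = 0 then y p.2 else w (1, p.2)) ∈ S} := by
  have h1 := hR.preimage_comp (fun p : Fin 2 × κ =>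
    if p.1 = 0 then (Sum.inl (0, p.2) : (Fin 2 × κ) ⊕ κ) else Sum.inr p.2)
  have h2 := hS.preimage_comp (fun p : Fin 2 × κ =>
    if p.1 = 0 then (Sum.inr p.2 : (Fin 2 × κ) ⊕ κ) else Sum.inl (1, p.2))
  convert (h1.inter h2).exists_of_finite using 1
  ext w
  simp only [mem_ofPred_eq, mem_inter_iff, mem_preimage]
  refine exists_congr fun y => ?_
  have e1 : (Sum.elim w y ∘ fun p : Fin 2 × κ =>
      if p.1 = 0 then (Sum.inl (0, p.2) : (Fin 2 × κ) ⊕ κ) else Sum.inr p.2) =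
      fun p : Fin 2 × κ => if p.1 = 0 then w (0, p.2) else y p.2 := by
    funext p; by_cases h : p.1 = 0 <;> simp [h]
  have e2 : (Sum.elim w y ∘ fun p : Fin 2 × κ =>
      if p.1 = 0 then (Sum.inr p.2 : (Fin 2 × κ) ⊕ κ) else Sum.inl (1, p.2)) =
      fun p : Fin 2 × κ => if p.1 = 0 then y p.2 else w (1, p.2) := by
    funext p; by_cases h : p.1 = 0 <;> simp [h]
  rw [e1, e2]

theorem pair_mem_pullback_eq {ι : Type} {M N : Type*} (f : CoordMap ι N M) (x y : ι → N) :
    (fun p : Fin 2 × ι => if p.1 = 0 then x p.2 else y p.2) ∈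
      f.pullback {v : Fin 2 → M | v 0 = v 1} ↔
      ∃ (hx : x ∈ f.domain) (hy : y ∈ f.domain), f.toFun ⟨x, hx⟩ = f.toFun ⟨y, hy⟩ := by
  constructor
  · rintro ⟨h, h'⟩
    exact ⟨h 0, h 1, h'⟩
  · rintro ⟨hx, hy, h⟩
    refine ⟨fun j => ?_, h⟩
    fin_cases j
    · exact hx
    · exact hy

theorem IsInterpretation.definable_pullback_rank_le {L : FirstOrder.Language} [L.Structure M]
    {f : CoordMap ι ℤ M} (hf : f.IsInterpretation L rngLanguage) :
    univ.Definable rngLanguage (f.pullback {v : Fin 2 → M | f.rank (v 0) ≤ f.rank (v 1)}) := by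
  -- `h1` relates `x` to `y'` when some code equivalent to `x` is no higher than `y'`; `h2` says
  -- that this fails for some code `y'` equivalent to `y`, so on codes its complement compares
  -- ranks.
  have h1 := hf.eq.relComp definable_height_le
  have h2 := h1.compl.relComp hf.eq
  have h0 : ∀ j : Fin 2, univ.Definable rngLanguage
      {w : Fin 2 × ι → ℤ | (fun i => w (j, i)) ∈ f.domain} := fun j =>
    hf.domain.preimage_comp fun i => (j, i)
  convert ((h0 0).inter (h0 1)).inter h2.compl using 1
  ext w
  obtain ⟨x, y, rfl⟩ : ∃ x y : ι → ℤ,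
      w = fun p : Fin 2 × ι => if p.1 = 0 then x p.2 else y p.2 := by
    refine ⟨fun i => w (0, i), fun i => w (1, i), ?_⟩
    funext ⟨j, i⟩
    fin_cases j <;> simp
  simp only [mem_inter_iff, mem_compl_iff, mem_ofPred_eq, not_exists, not_and,
    pair_mem_pullback_eq, if_true, one_ne_zero, if_false]
  constructor
  · rintro ⟨h, h'⟩
    refine ⟨⟨h 0, h 1⟩, fun y' h1 hy' hy e => ?_⟩
    obtain ⟨⟨x', hx'⟩, e', hh⟩ := (f.rank_le_rank _ _).1 h' ⟨y', hy'⟩ e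
    exact h1 x' ⟨h 0, hx', e'.symm⟩ hh
  · rintro ⟨⟨hx, hy⟩, h⟩
    have hd : ∀ j : Fin 2,
        (fun i => if j = 0 then x i else y i) ∈ f.domain := by
      intro j
      fin_cases j
      · exact hx
      · exact hy
    refine ⟨hd, (f.rank_le_rank _ _).2 ?_⟩
    rintro ⟨y', hy'⟩ e
    by_contra hn
    refine h y' ?_ hy' hy e
    rintro x' ⟨_, hx', e'⟩ hh
    exact hn ⟨⟨x', hx'⟩, e'.symm, hh⟩

/-! ### Transport to a structure bi-interpretable with the integers -/

/-- Along a definable isomorphism with a copy, definability of a set of codes passes to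
definability of a set of elements. -/
theorem exists_equiv_definable {κ : Type} [Finite κ] {M : Type*} {L : FirstOrder.Language}
    [L.Structure M] {h : CoordMap κ M M} (hh : h.HasDefinableIso L) :
    ∃ θ : M ≃ M, ∀ {γ : Type} [Finite γ] {S : Set (γ → M)}, univ.Definable L (h.pullback S) →
      univ.Definable L {v : γ → M | θ ∘ v ∈ S} := by
  obtain ⟨Φ, hΦ⟩ := hh
  refine ⟨Φ.toEquiv.trans h.copyEquiv, fun {γ} _ {S} hS => ?_⟩
  have hmk : ∀ x, h.copyEquiv (Copy.mk h x) = h.toFun x := fun x => rfl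
  have h1 : ∀ j : γ, univ.Definable L _ := fun j => hΦ.preimage_comp
    (fun o : Option κ => o.elim (Sum.inl j : γ ⊕ (γ × κ)) fun k => Sum.inr (j, k))
  have h2 := (definable_iInter_of_finite h1).inter (hS.preimage_comp (Sum.inr : _ → γ ⊕ (γ × κ)))
  convert h2.exists_of_finite using 1
  ext v
  simp only [mem_ofPred_eq, mem_inter_iff, mem_iInter, mem_preimage]
  constructor
  · intro hv
    obtain ⟨z, hz⟩ := h.exists_codes ((Φ.toEquiv.trans h.copyEquiv) ∘ v)
    refine ⟨fun p => (z p.1).1 p.2, fun j => ⟨(z j).2, ?_⟩, fun j => (z j).2, ?_⟩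
    · apply h.copyEquiv.injective
      exact (congrFun hz j).symm
    · change (fun j => h.toFun (z j)) ∈ S
      rw [hz]
      exact hv
  · rintro ⟨u, hu, hd, hS⟩
    have : ((Φ.toEquiv.trans h.copyEquiv) ∘ v) = fun j => h.toFun ⟨_, hd j⟩ := by
      funext j
      obtain ⟨hj, e⟩ := hu j
      exact congrArg h.copyEquiv e
    rw [this]
    exact hS

theorem pullback_comp {ι κ : Type} {A B C : Type*} (f : CoordMap ι B C) (g : CoordMap κ A B)
    {γ : Type} (S : Set (γ → C)) :
    (f.comp g).pullback S =
      (fun x : γ × (ι × κ) → A => x ∘ Equiv.prodAssoc γ ι κ) ⁻¹' g.pullback (f.pullback S) := by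
  ext x
  constructor
  · rintro ⟨h, hS⟩
    exact ⟨fun p => (h p.1).1 p.2, fun j => (h j).2, hS⟩
  · rintro ⟨h, h', hS⟩
    exact ⟨fun j => ⟨fun i => h (j, i), h' j⟩, hS⟩

end CoordMap

/-- A structure that is bi-interpretable with the integers carries a definable total preorder with
finite initial segments. -/
theorem BiInterpretable.exists_definable_rank {L : FirstOrder.Language} {M : Type*}
    [L.Structure M] (h : BiInterpretable L rngLanguage M ℤ) :
    ∃ r : M → ℕ, (∀ n, {a | r a ≤ n}.Finite) ∧
      univ.Definable L {v : Fin 2 → M | r (v 0) ≤ r (v 1)} := by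
  obtain ⟨d, e, f, g, hf, hg, hfg, -⟩ := h
  obtain ⟨θ, hθ⟩ := CoordMap.exists_equiv_definable hfg
  refine ⟨fun a => f.rank (θ a), fun n => ?_, ?_⟩
  · exact (f.finite_rank_le n).preimage θ.injective.injOn
  -- Pulling back along `f` lands in `ℤ`, then along `g` in `M`; together this is the pullback along
  -- `f.comp g`, to which `θ` applies.
  · apply hθ (S := {v : Fin 2 → M | f.rank (v 0) ≤ f.rank (v 1)})
    rw [CoordMap.pullback_comp]
    exact (hg.definable_pullback hf.definable_pullback_rank_le).preimage_comp _

/-! ### Automorphisms of ultrapowers and definable sets -/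

open Filter

/-- A transformation of sequences that induces an automorphism of an ultrapower, fixing the
constants, preserves the sets that are definable with parameters. -/
theorem Set.Definable.eventually_mem_iff {A : Type*} [NonUnitalNonAssocRing A] {γ : Type*}
    {S : Set (γ → A)} (hS : univ.Definable rngLanguage S) (u : Ultrafilter ℕ)
    (σ τ : (ℕ → A) → ℕ → A)
    (hσ : ∀ x y, x =ᶠ[u] y → σ x =ᶠ[u] σ y) (hτ : ∀ x y, x =ᶠ[u] y → τ x =ᶠ[u] τ y)
    (hστ : ∀ x, σ (τ x) =ᶠ[u] x) (hτσ : ∀ x, τ (σ x) =ᶠ[u] x)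
    (hadd : ∀ x y, σ (x + y) =ᶠ[u] σ x + σ y) (hmul : ∀ x y, σ (x * y) =ᶠ[u] σ x * σ y)
    (hconst : ∀ a : A, (σ fun _ => a) =ᶠ[u] fun _ => a) (x : γ → ℕ → A) :
    (∀ᶠ i in u, (fun j => x j i) ∈ S) ↔ ∀ᶠ i in u, (fun j => σ (x j) i) ∈ S := by
  obtain ⟨φ, rfl⟩ := definable_iff_exists_formula_sum.1 hS
  let P := (u : Filter ℕ).Product fun _ => A
  let mk : (ℕ → A) → P := Quotient.mk _
  have hmk : ∀ {x y}, mk x = mk y ↔ x =ᶠ[u] y := Quotient.eq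
  let E : P ≃[rngLanguage] P :=
    { toFun := Quotient.map σ hσ
      invFun := Quotient.map τ hτ
      left_inv := by
        rintro ⟨x⟩
        exact hmk.2 (hτσ x)
      right_inv := by
        rintro ⟨x⟩
        exact hmk.2 (hστ x)
      map_fun' := by
        intro n F v
        obtain ⟨w, rfl⟩ : ∃ w : Fin n → ℕ → A, (fun i => mk (w i)) = v :=
          ⟨fun i => (v i).out, funext fun i => Quotient.out_eq _⟩
        have h1 := Language.Ultraproduct.funMap_cast (u := u) F w
        have h2 := Language.Ultraproduct.funMap_cast (u := u) F fun i => σ (w i)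
        refine (congrArg (Quotient.map σ hσ) h1).trans (Eq.trans ?_ h2.symm)
        cases F with
        | add => exact hmk.2 (hadd _ _)
        | mul => exact hmk.2 (hmul _ _)
      map_rel' := by
        intro n R
        exact R.elim }
  -- Łoś's theorem is applied before and after `σ`, with each parameter replaced by its constant
  -- sequence.
  have h1 := Language.Ultraproduct.realize_formula_cast (u := u) φ
    (Sum.elim (fun (a : (univ : Set A)) (_ : ℕ) => (a : A)) x)
  have h2 := Language.Ultraproduct.realize_formula_cast (u := u) φ
    (Sum.elim (fun (a : (univ : Set A)) (_ : ℕ) => (a : A)) fun j => σ (x j))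
  have e : ∀ (y : γ → ℕ → A) (i : ℕ),
      (fun k => (Sum.elim (fun (a : (univ : Set A)) (_ : ℕ) => (a : A)) y) k i) =
        Sum.elim (fun a : (univ : Set A) => (a : A)) fun j => y j i := by
    intro y i
    funext k
    cases k <;> rfl
  simp only [e] at h1 h2
  refine h1.symm.trans (Iff.trans ?_ h2)
  refine (Language.StrongHomClass.realize_formula E φ).symm.trans ?_
  refine iff_of_eq (congrArg _ ?_)
  funext k
  rcases k with a | j
  · exact hmk.2 (hconst a)
  · rfl

/-! ### Transvections of the ultrapower -/

section Shift

variable {A : Type*} [NonUnitalNonAssocRing A] (u : Ultrafilter ℕ) (π : A →+ ℤ) (z : A)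
  (N : ℕ → ℕ) (ψ : (u : Filter ℕ).Germ ℚ →ₗ[ℚ] ℚ)

/-- The germ of the images of a sequence under `π`. -/
def germMap (x : ℕ → A) : (u : Filter ℕ).Germ ℚ := ((fun i => (π (x i) : ℚ)) : ℕ → ℚ)

/-- The rational multiples of the sequence `N • z`, where `N` is divisible in the ultrapower. -/
def ratMultiple (s : ℚ) (i : ℕ) : A := ⌊s * N i⌋ • z

/-- The transvection `x ↦ x + t ψ(π x) N z`. -/
def transvection (t : ℚ) (x : ℕ → A) : ℕ → A := x + ratMultiple z N (t * ψ (germMap u π x))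

variable {u π z N ψ}

theorem germMap_congr {x y : ℕ → A} (h : x =ᶠ[u] y) : germMap u π x = germMap u π y :=
  Germ.coe_eq.2 (h.mono fun i hi => by simp only [hi])

theorem germMap_add (x y : ℕ → A) : germMap u π (x + y) = germMap u π x + germMap u π y := by
  rw [germMap, germMap, germMap, ← Germ.coe_add]
  exact congrArg _ (funext fun i => by simp)

theorem germMap_const (a : A) : germMap u π (fun _ => a) = (π a : ℚ) • 1 := by
  rw [germMap, ← Germ.coe_one, ← Germ.coe_smul]
  exact congrArg _ (funext fun i => by simp)

/-- The denominator of `s` divides `N i` almost everywhere, so the floor loses nothing. -/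
theorem eventually_floor_mul (hN : ∀ m : ℕ, 0 < m → ∀ᶠ i in u, m ∣ N i) (s : ℚ) :
    ∀ᶠ i in u, (⌊s * N i⌋ : ℚ) = s * N i := by
  filter_upwards [hN s.den s.den_pos] with i ⟨k, hk⟩
  have : s * N i = ((s.num * k : ℤ) : ℚ) := by
    rw [hk]
    push_cast
    rw [← mul_assoc, Rat.mul_den_eq_num]
  rw [this, Int.floor_intCast]

theorem ratMultiple_add (hN : ∀ m : ℕ, 0 < m → ∀ᶠ i in u, m ∣ N i) (s t : ℚ) :
    ratMultiple z N (s + t) =ᶠ[u] ratMultiple z N s + ratMultiple z N t := by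
  filter_upwards [eventually_floor_mul hN s, eventually_floor_mul hN t,
    eventually_floor_mul hN (s + t)] with i h1 h2 h3
  have : ⌊(s + t) * N i⌋ = ⌊s * N i⌋ + ⌊t * N i⌋ := by
    have h : (⌊(s + t) * N i⌋ : ℚ) = ⌊s * N i⌋ + ⌊t * N i⌋ := by rw [h1, h2, h3]; ring
    exact_mod_cast h
  simp only [ratMultiple, Pi.add_apply, this, add_smul]

theorem ratMultiple_zero : ratMultiple z N 0 = 0 := by
  funext i
  simp [ratMultiple]

theorem ratMultiple_natCast (k i : ℕ) : ratMultiple z N k i = (k * N i) • z := by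
  rw [ratMultiple, ← Nat.cast_mul, Int.floor_natCast, natCast_zsmul]

theorem germMap_ratMultiple (hN : ∀ m : ℕ, 0 < m → ∀ᶠ i in u, m ∣ N i) (s : ℚ) :
    germMap u π (ratMultiple z N s) = s • germMap u π (ratMultiple z N 1) := by
  rw [germMap, germMap, ← Germ.coe_smul]
  refine Germ.coe_eq.2 ?_
  filter_upwards [eventually_floor_mul hN s] with i hi
  simp only [ratMultiple, map_zsmul, smul_eq_mul, Int.cast_mul, hi, Pi.smul_apply, one_mul,
    Int.floor_natCast, Int.cast_natCast]
  ring

theorem transvection_congr (t : ℚ) {x y : ℕ → A} (h : x =ᶠ[u] y) :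
    transvection u π z N ψ t x =ᶠ[u] transvection u π z N ψ t y := by
  rw [transvection, transvection, germMap_congr h]
  exact h.add (EventuallyEq.refl _ _)

/-- Since `π z` may be nonzero, a transvection can rescale `ψ ∘ π`; this factor governs its inverse.
-/
theorem apply_germMap_transvection (hN : ∀ m : ℕ, 0 < m → ∀ᶠ i in u, m ∣ N i) (t : ℚ)
    (x : ℕ → A) : ψ (germMap u π (transvection u π z N ψ t x)) =
      ψ (germMap u π x) * (1 + t * ψ (germMap u π (ratMultiple z N 1))) := by
  rw [transvection, germMap_add, germMap_ratMultiple hN, map_add, map_smul, smul_eq_mul]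
  ring

theorem transvection_transvection (hN : ∀ m : ℕ, 0 < m → ∀ᶠ i in u, m ∣ N i) {s t : ℚ}
    (hst : s + t + s * t * ψ (germMap u π (ratMultiple z N 1)) = 0) (x : ℕ → A) :
    transvection u π z N ψ s (transvection u π z N ψ t x) =ᶠ[u] x := by
  rw [transvection, apply_germMap_transvection hN, transvection, add_assoc]
  have h := ratMultiple_add (z := z) hN (t * ψ (germMap u π x)) (s * (ψ (germMap u π x) *
    (1 + t * ψ (germMap u π (ratMultiple z N 1)))))
  have e : t * ψ (germMap u π x) + s * (ψ (germMap u π x) *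
      (1 + t * ψ (germMap u π (ratMultiple z N 1)))) = 0 := by
    linear_combination ψ (germMap u π x) * hst
  rw [e, ratMultiple_zero] at h
  simpa using (EventuallyEq.refl _ x).add h.symm

theorem transvection_add (hN : ∀ m : ℕ, 0 < m → ∀ᶠ i in u, m ∣ N i) (t : ℚ) (x y : ℕ → A) :
    transvection u π z N ψ t (x + y) =ᶠ[u]
      transvection u π z N ψ t x + transvection u π z N ψ t y := by
  simp only [transvection, germMap_add, map_add, mul_add]
  filter_upwards [ratMultiple_add (z := z) hN (t * ψ (germMap u π x)) (t * ψ (germMap u π y))]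
    with i hi
  simp only [Pi.add_apply] at hi ⊢
  rw [hi]
  abel

theorem transvection_of_apply_eq_zero (t : ℚ) {x : ℕ → A} (hx : ψ (germMap u π x) = 0) :
    transvection u π z N ψ t x = x := by
  rw [transvection, hx, mul_zero, ratMultiple_zero, add_zero]

/-- Products are fixed because `π` kills them, and the added multiples of `z` annihilate everything
on the right. -/
theorem transvection_mul (hπ : ∀ x y, π (x * y) = 0) (hz : z ∈ ringAnn A) (t : ℚ) (x y : ℕ → A) :
    transvection u π z N ψ t (x * y) =
      transvection u π z N ψ t x * transvection u π z N ψ t y := by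
  have h : germMap u π (x * y) = 0 := by
    rw [germMap]
    exact congrArg _ (funext fun i => by simp [hπ])
  rw [transvection_of_apply_eq_zero t (by rw [h, map_zero])]
  have hr : ∀ s i y, ratMultiple z N s i * y = 0 ∧ y * ratMultiple z N s i = 0 := fun s i y =>
    (ringAnn A).zsmul_mem hz _ y
  funext i
  simp [transvection, add_mul, mul_add, (hr _ _ _).1, (hr _ _ _).2]

theorem not_eventually_rank_le (hπ : ∀ x y, π (x * y) = 0) (hz : z ∈ ringAnn A)
    (hz' : Function.Injective fun n : ℕ => n • z) {r : A → ℕ} (hr : ∀ n, {a | r a ≤ n}.Finite)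
    (hdef : univ.Definable rngLanguage {v : Fin 2 → A | r (v 0) ≤ r (v 1)})
    (hu : (u : Filter ℕ) ≤ atTop) {a b : ℕ → A}
    (hab : germMap u π a ∉ Submodule.span ℚ {1, germMap u π b}) :
    ¬ ∀ᶠ i in u, r (a i) ≤ r (b i) := by
  intro hle
  obtain ⟨ψ, hψ1, hψa, hψb⟩ : ∃ ψ : (u : Filter ℕ).Germ ℚ →ₗ[ℚ] ℚ,
      ψ 1 = 0 ∧ ψ (germMap u π a) = 1 ∧ ψ (germMap u π b) = 0 := by
    obtain ⟨ψ, h1, h2⟩ := Submodule.exists_le_ker_of_notMem hab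
    refine ⟨(ψ (germMap u π a))⁻¹ • ψ, ?_, ?_, ?_⟩
    · have : ψ 1 = 0 := h2 (Submodule.subset_span (by simp))
      simp [this]
    · simp [h1]
    · have : ψ (germMap u π b) = 0 := h2 (Submodule.subset_span (by simp))
      simp [this]
  have hfin : ∀ i k : ℕ, 0 < k →
      {n : ℕ | r (a i + (k * (n * i.factorial)) • z) ≤ r (b i)}.Finite := by
    intro i k hk
    refine (hr (r (b i))).preimage (f := fun n : ℕ => a i + (k * (n * i.factorial)) • z) ?_
    intro n _ m _ h
    have h' := hz' (add_left_cancel h)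
    have := i.factorial_pos
    exact Nat.eq_of_mul_eq_mul_right this (Nat.eq_of_mul_eq_mul_left hk h')
  -- `N` must be fixed before `k`, because the invertibility condition involves `N`; hence the
  -- shifts by `N z` and `2 N z` both leave the initial segment of `b i`. The factorial supplies
  -- divisibility.
  choose n hn using fun i =>
    ((hfin i 1 one_pos).union (hfin i 2 two_pos)).exists_notMem
  let N : ℕ → ℕ := fun i => n i * i.factorial
  have hN : ∀ m : ℕ, 0 < m → ∀ᶠ i in u, m ∣ N i := by
    intro m hm
    filter_upwards [hu (eventually_ge_atTop m)] with i hi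
    exact (Nat.dvd_factorial hm hi).mul_left _
  -- The factor `1 + k c` cannot vanish for both values of `k`.
  obtain ⟨k, hk, hk0⟩ : ∃ k : ℕ, (k = 1 ∨ k = 2) ∧
      1 + (k : ℚ) * ψ (germMap u π (ratMultiple z N 1)) ≠ 0 := by
    by_contra! h
    have h1 := h 1 (Or.inl rfl)
    have h2 := h 2 (Or.inr rfl)
    push_cast at h1 h2
    linarith
  set c := ψ (germMap u π (ratMultiple z N 1)) with hc
  have hinv : (-k / (1 + k * c) : ℚ) + k + (-k / (1 + k * c)) * k * c = 0 := by
    field_simp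
    ring
  have key := (hdef.eventually_mem_iff u (transvection u π z N ψ k)
    (transvection u π z N ψ (-k / (1 + k * c)))
    (fun _ _ => transvection_congr _) (fun _ _ => transvection_congr _)
    (transvection_transvection hN (by rw [← hc, ← hinv]; ring))
    (transvection_transvection hN hinv)
    (transvection_add hN _) (fun x y => by rw [transvection_mul hπ hz])
    (fun a => by rw [transvection_of_apply_eq_zero _ (by simp [germMap_const, hψ1])])
    ![a, b]).1 hle
  obtain ⟨i, hi⟩ := key.exists
  have hi' : r (transvection u π z N ψ k a i) ≤ r (transvection u π z N ψ k b i) := hi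
  rw [transvection_of_apply_eq_zero _ hψb, transvection, hψa, mul_one, Pi.add_apply,
    ratMultiple_natCast] at hi'
  refine hn i ?_
  rcases hk with rfl | rfl
  · exact Or.inl hi'
  · exact Or.inr hi'

end Shift

/-! ### Two incomparable sequences -/

/-- Sets in a nonprincipal ultrafilter are infinite, and a nonzero polynomial has finitely many
roots. -/
theorem eq_zero_of_eventually_quadratic {c₀ c₁ c₂ : ℚ}
    (h : ∀ᶠ i : ℕ in hyperfilter ℕ, c₀ + c₁ * i + c₂ * i ^ 2 = 0) : c₁ = 0 ∧ c₂ = 0 := by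
  have hinf : {i : ℕ | c₀ + c₁ * i + c₂ * i ^ 2 = 0}.Infinite := fun hf =>
    notMem_hyperfilter_of_finite hf h
  have hP : (Polynomial.C c₀ + Polynomial.C c₁ * Polynomial.X +
      Polynomial.C c₂ * Polynomial.X ^ 2) = 0 := by
    refine Polynomial.eq_zero_of_infinite_isRoot _
      ((hinf.image Nat.cast_injective.injOn).mono ?_)
    rintro _ ⟨i, hi, rfl⟩
    simpa [Polynomial.IsRoot] using hi
  have h1 := congrArg (fun P => Polynomial.coeff P 1) hP
  have h2 := congrArg (fun P => Polynomial.coeff P 2) hP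
  simp [Polynomial.coeff_C, Polynomial.coeff_X_pow] at h1 h2
  exact ⟨h1, h2⟩

theorem not_exists_definable_rank {A : Type*} [NonUnitalNonAssocRing A] {π : A →+ ℤ}
    (hπ : ∀ x y, π (x * y) = 0) {e : A} (he : π e ≠ 0) {z : A} (hz : z ∈ ringAnn A)
    (hz' : Function.Injective fun n : ℕ => n • z) :
    ¬ ∃ r : A → ℕ, (∀ n, {a | r a ≤ n}.Finite) ∧
      univ.Definable rngLanguage {v : Fin 2 → A | r (v 0) ≤ r (v 1)} := by
  rintro ⟨r, hr, hdef⟩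
  have he' : (π e : ℚ) ≠ 0 := by exact_mod_cast he
  have hu : (hyperfilter ℕ : Filter ℕ) ≤ atTop := Nat.hyperfilter_le_atTop
  have h1 := not_eventually_rank_le (u := hyperfilter ℕ) hπ hz hz' hr hdef hu
    (a := fun i => i • e) (b := fun i => i ^ 2 • e) (by
      rw [Submodule.mem_span_pair]
      rintro ⟨s, t, h⟩
      rw [germMap, germMap, ← Germ.coe_one, ← Germ.coe_smul, ← Germ.coe_smul, ← Germ.coe_add,
        Germ.coe_eq] at h
      have := eq_zero_of_eventually_quadratic (c₀ := s) (c₁ := -π e) (c₂ := t * π e)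
        (h.mono fun i hi => by
          simp at hi
          linear_combination hi)
      exact he' (neg_eq_zero.1 this.1))
  have h2 := not_eventually_rank_le (u := hyperfilter ℕ) hπ hz hz' hr hdef hu
    (a := fun i => i ^ 2 • e) (b := fun i => i • e) (by
      rw [Submodule.mem_span_pair]
      rintro ⟨s, t, h⟩
      rw [germMap, germMap, ← Germ.coe_one, ← Germ.coe_smul, ← Germ.coe_smul, ← Germ.coe_add,
        Germ.coe_eq] at h
      have := eq_zero_of_eventually_quadratic (c₀ := s) (c₁ := t * π e) (c₂ := -π e)
        (h.mono fun i hi => by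
          simp at hi
          linear_combination hi)
      exact he' (neg_eq_zero.1 this.2))
  -- An ultrafilter decides every statement, so failure of one comparison yields the reverse one
  -- almost everywhere.
  rw [← Ultrafilter.eventually_not] at h1
  exact h2 (h1.mono fun i hi => (not_le.1 hi).le)

/-! ### The functional and the annihilating element -/

/-- The quotient by an isolator is torsion-free, hence free when finitely generated; `π` is a
coordinate that does not vanish on a chosen nonzero class. -/
theorem exists_addMonoidHom_ne_zero {A : Type*} [NonUnitalNonAssocRing A] (hA : AddGroup.FG A)
    (hDelta : ringDelta A ≠ ⊤) : ∃ π : A →+ ℤ, (∀ x y, π (x * y) = 0) ∧ ∃ e, π e ≠ 0 := by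
  have : Module.Finite ℤ A := Module.Finite.iff_addGroup_fg.2 hA
  let Q := A ⧸ (ringDelta A).toIntSubmodule
  have hQ : Module.IsTorsionFree ℤ Q := by
    refine ⟨fun n hn => (isSMulRegular_iff_right_eq_zero_of_smul).2 ?_⟩
    intro x hx
    obtain ⟨a, rfl⟩ := Submodule.Quotient.mk_surjective _ x
    rw [← Submodule.Quotient.mk_smul, Submodule.Quotient.mk_eq_zero] at hx
    obtain ⟨m, hm, k, x, y, hxy⟩ := hx
    refine (Submodule.Quotient.mk_eq_zero _).2 ⟨m * n.natAbs,
      Nat.mul_pos hm (Int.natAbs_pos.2 hn.ne_zero), ?_⟩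
    have hmem : m • n • a ∈ ringSq A := ⟨k, x, y, hxy⟩
    rw [mul_smul]
    rcases Int.natAbs_eq n with h | h
    · rw [h, natCast_zsmul] at hmem
      exact hmem
    · rw [h, neg_smul, natCast_zsmul, smul_neg] at hmem
      exact neg_mem_iff.1 hmem
  have : Module.Free ℤ Q := Module.free_of_finite_type_torsion_free'
  obtain ⟨e, he⟩ : ∃ e, e ∉ ringDelta A := by
    by_contra! h
    exact hDelta ((AddSubgroup.eq_top_iff' _).2 h)
  have he' : (Submodule.Quotient.mk e : Q) ≠ 0 := fun h =>
    he ((Submodule.Quotient.mk_eq_zero _).1 h)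
  let B := Module.Free.chooseBasis ℤ Q
  obtain ⟨j, hj⟩ : ∃ j, B.coord j (Submodule.Quotient.mk e) ≠ 0 := by
    by_contra! h
    exact he' (B.forall_coord_eq_zero_iff.1 h)
  refine ⟨((B.coord j).comp (Submodule.mkQ _)).toAddMonoidHom, fun x y => ?_, e, hj⟩
  have hxy : x * y ∈ ringDelta A :=
    ⟨1, one_pos, 1, fun _ => x, fun _ => y, by simp⟩
  have : (Submodule.Quotient.mk (x * y) : Q) = 0 := (Submodule.Quotient.mk_eq_zero _).2 hxy
  change B.coord j (Submodule.Quotient.mk (x * y)) = 0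
  rw [this, map_zero]

/-- The annihilator inherits finite generation, and a finitely generated torsion abelian group is
finite. -/
theorem exists_mem_ringAnn_injective {A : Type*} [NonUnitalNonAssocRing A] (hA : AddGroup.FG A)
    (hAnn : Infinite (ringAnn A)) :
    ∃ z ∈ ringAnn A, Function.Injective fun n : ℕ => n • z := by
  have : Module.Finite ℤ A := Module.Finite.iff_addGroup_fg.2 hA
  have : Module.Finite ℤ (ringAnn A).toIntSubmodule := inferInstance
  have hfg : AddGroup.FG (ringAnn A) := Module.Finite.iff_addGroup_fg.1 this
  by_contra! h
  have := AddCommGroup.finite_of_fg_isAddTorsion (ringAnn A) fun z => by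
    have hz := h z z.2
    rw [injective_nsmul_iff_not_isOfFinAddOrder, not_not] at hz
    exact AddSubmonoid.isOfFinAddOrder_coe.1 hz
  exact not_finite (ringAnn A)

end

theorem theorem1p12 (A : Type*) [NonUnitalNonAssocRing A]
    (hFDZ : AddGroup.FG A)
    (hAnn : Infinite (ringAnn A))
    (hDelta : ringDelta A ≠ ⊤) :
    ¬ BiInterpretable rngLanguage rngLanguage A ℤ := by
  intro h
  obtain ⟨π, hπ, e, he⟩ := exists_addMonoidHom_ne_zero hFDZ hDelta
  obtain ⟨z, hz, hz'⟩ := exists_mem_ringAnn_injective hFDZ hAnn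
  exact not_exists_definable_rank hπ he hz hz' h.exists_definable_rank
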